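/- Let $\Omega\subset\mathbb R^3$ be open, let $\epsilon>0$, and let $d_\epsilon\in H^1(\Omega,\mathbb R^3)$ be a weak solution of $$\Delta d_\epsilon+\frac1{\epsilon^2}(1-|d_\epsilon|^2)d_\epsilon=\tau_\epsilon\quad\text{in }\Omega,$$ where $|d_\epsilon|\le 1$ a.e. in $\Omega$ and $\tau_\epsilon\in L^2(\Omega,\mathbb R^3)$. Let $$e_\epsilon(d_\epsilon)=\frac12|\nabla d_\epsilon|^2+\frac{3}{4\epsilon^2}(1-|d_\epsilon|^2)^2$$ and, for $x_0\in\Omega$ and $\rho>0$ with $B_\rho(x_0)\subset\Omega$, let $$\Phi^\epsilon(\rho)=\frac1\rho\int_{B_\rho(x_0)}\Big(e_\epsilon(d_\epsilon)-\big\langle (x-x_0)\cdot\nabla d_\epsilon,\tau_\epsilon\big\rangle\Big)\,dx+\frac12\int_{B_\rho(x_0)}|x-x_0|\,|\tau_\epsilon|^2\,dx .$$ Then, for every $x_0\in\Omega$ and all $0<r\le R<\mathrm{dist}(x_0,\partial\Omega)$ (where the distance to the empty set is $+\infty$), $$\Phi^\epsilon(R)\ \ge\ \Phi^\epsilon(r)+\frac12\int_{B_R(x_0)\setminus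 B_r(x_0)}\frac1{|x-x_0|}\Big(\Big|\frac{\partial d_\epsilon}{\partial|x-x_0|}\Big|^2+\frac{(1-|d_\epsilon|^2)^2}{\epsilon^2}\Big)\,dx,$$ where $\dfrac{\partial d_\epsilon}{\partial |x-x_0|}=\dfrac{x-x_0}{|x-x_0|}\cdot\nabla d_\epsilon$ is the radial derivative. -/

import Mathlib

open MeasureTheory
open scoped ContDiff RealInnerProductSpace

/-- The Euclidean space `ℝ³`, used both for the domain and for the target. -/
abbrev E3 : Type := EuclideanSpace ℝ (Fin 3)

/-- The classical partial derivative `∂φ/∂xᵢ` of a (smooth) scalar function on `ℝ³`. -/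
noncomputable def partialDeriv (i : Fin 3) (φ : E3 → ℝ) (x : E3) : ℝ :=
  fderiv ℝ φ x (EuclideanSpace.single i 1)

/-- `φ ∈ C_c^∞(Ω)`. -/
structure IsTestFunction (Ω : Set E3) (φ : E3 → ℝ) : Prop where
  smooth : ContDiff ℝ ∞ φ
  compact_support : HasCompactSupport φ
  support_subset : tsupport φ ⊆ Ω

/-- `g` is the weak partial derivative `∂d/∂xᵢ` on `Ω` of the vector-valued function `d`.
Values outside `Ω` play no role. -/
structure HasWeakPartialDeriv (Ω : Set E3) (i : Fin 3) (d g : E3 → E3) : Prop where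
  locallyIntegrable : LocallyIntegrableOn d Ω volume
  locallyIntegrable_deriv : LocallyIntegrableOn g Ω volume
  integral_eq : ∀ φ : E3 → ℝ, IsTestFunction Ω φ →
    ∫ x in Ω, partialDeriv i φ x • d x = -∫ x in Ω, φ x • g x

/-- `d ∈ H¹(Ω, ℝ³)`, with weak gradient `G = (∂₁d, ∂₂d, ∂₃d)` (which is determined by `d` up to
null sets). -/
structure IsH1WithGradient (Ω : Set E3) (d : E3 → E3) (G : Fin 3 → E3 → E3) : Prop where
  memLp : MemLp d 2 (volume.restrict Ω)
  memLp_grad : ∀ i, MemLp (G i) 2 (volume.restrict Ω)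
  weakDeriv : ∀ i, HasWeakPartialDeriv Ω i d (G i)

/-- `d`, with weak gradient `G`, is a weak solution in `Ω` of the approximated Ginzburg-Landau
equation `Δd + ε⁻² (1 - |d|²) d = τ`. -/
def IsWeakSolutionAGL (Ω : Set E3) (ε : ℝ) (d : E3 → E3) (G : Fin 3 → E3 → E3)
    (τ : E3 → E3) : Prop :=
  ∀ φ : E3 → ℝ, IsTestFunction Ω φ →
    -(∫ x in Ω, ∑ i, partialDeriv i φ x • G i x)
        + ∫ x in Ω, φ x • ((1 / ε ^ 2 * (1 - ‖d x‖ ^ 2)) • d x)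
      = ∫ x in Ω, φ x • τ x

/-- `|∇d|² = ∑ᵢ |∂ᵢd|²` at `x`. -/
noncomputable def gradSq (G : Fin 3 → E3 → E3) (x : E3) : ℝ :=
  ∑ i, ‖G i x‖ ^ 2

/-- The directional derivative `v · ∇d = ∑ᵢ vᵢ ∂ᵢd` at `x`. -/
noncomputable def dirDeriv (G : Fin 3 → E3 → E3) (v x : E3) : E3 :=
  ∑ i, v i • G i x

/-- The radial derivative `∂d/∂|x - x₀| = ((x - x₀) / |x - x₀|) · ∇d`. -/
noncomputable def radialDeriv (G : Fin 3 → E3 → E3) (x₀ x : E3) : E3 :=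
  dirDeriv G (‖x - x₀‖⁻¹ • (x - x₀)) x

/-- The modified Ginzburg-Landau energy density
`e_ε(d) = ½ |∇d|² + 3 / (4 ε²) (1 - |d|²)²`. -/
noncomputable def energyDensity (ε : ℝ) (d : E3 → E3) (G : Fin 3 → E3 → E3) (x : E3) : ℝ :=
  1 / 2 * gradSq G x + 3 / (4 * ε ^ 2) * (1 - ‖d x‖ ^ 2) ^ 2

/-- The modified renormalized energy `Φ^ε(ρ)` centred at `x₀`. -/
noncomputable def renormalizedEnergy (ε : ℝ) (d : E3 → E3) (G : Fin 3 → E3 → E3) (τ : E3 → E3)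
    (x₀ : E3) (ρ : ℝ) : ℝ :=
  1 / ρ * (∫ x in Metric.ball x₀ ρ,
      (energyDensity ε d G x - ⟪dirDeriv G (x - x₀) x, τ x⟫))
    + 1 / 2 * ∫ x in Metric.ball x₀ ρ, ‖x - x₀‖ * ‖τ x‖ ^ 2

/-! Write `y = x - x₀`, `D = y · ∇d`, `W = (1 - |d|²)² / (4ε²)`. For a smooth map `v`, the
stress-energy tensor contracted with `y` is a vector field whose divergence is `⟨Δv + ε⁻²(1 -
|v|²)v, y · ∇v⟩ - e_ε(v)`; the dimension 3 produces the factor 3 in front of the potential.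
Integrating this divergence against `η = (1 / max |y| r - 1 / R)₊` gives a Pohozaev identity. This
weight is the integral over `ρ ∈ (r, R)` of `ρ⁻² 1_{B_ρ}`, so a single integration by parts gives
the integrated form of the derivative of `Φ`, with no slicing by spheres.

A weak solution has no second derivatives to insert. Since the smooth identity involves `Δv` and
uses no equation, it applies to mollifications of `d`: on `B_R` their gradient and Laplacian are the
mollifications of `G` and of `τ - ε⁻²(1 - |d|²)d`. The integrand is at most quadratic in these `L²`
data while `|d| ≤ 1`, so it passes to the limit by dominated convergence with varying majorants
(`integral_pohozaevIntegrand_eq_zero`).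

The limit identity equates the difference of the first terms of `Φ(R)` and `Φ(r)` with an integral
over the annulus. Adding `½ |y| |τ|²` and completing the square (`radial_defect_le`) bounds that
integral below by the defect. -/

theorem integral_fderiv_mul_eq_neg_lineDeriv_mul {E : Type*} [NormedAddCommGroup E]
    [InnerProductSpace ℝ E] [FiniteDimensional ℝ E] [MeasurableSpace E] [BorelSpace E]
    {μ : Measure E} [μ.IsAddHaarMeasure] {f g : E → ℝ} {C : NNReal}
    (hf : ContDiff ℝ 1 f) (hg : LipschitzWith C g) (hgc : HasCompactSupport g) (v : E) :
    ∫ x, fderiv ℝ f x v * g x ∂μ = -∫ x, lineDeriv ℝ g x v * f x ∂μ := by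
  obtain ⟨M, hM, hgM⟩ := hgc.isBounded.subset_ball_lt 0 0
  -- `f` need not be globally Lipschitz; multiplying by a bump equal to 1 near the support of `g`
  -- makes it so and changes neither integral.
  let χ : ContDiffBump (0 : E) := ⟨M, M + 1, hM, by linarith⟩
  have hχf : ContDiff ℝ 1 (fun x => χ x * f x) := χ.contDiff.mul hf
  have hχc : HasCompactSupport (fun x => χ x * f x) := χ.hasCompactSupport.mul_right
  obtain ⟨D, hD⟩ := hχf.lipschitzWith_of_hasCompactSupport hχc one_ne_zero
  have heq : ∀ x ∈ tsupport g, (fun x => χ x * f x) =ᶠ[nhds x] f := by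
    intro x hx
    filter_upwards [Metric.isOpen_ball.mem_nhds (hgM hx)] with y hy
    rw [χ.one_of_mem_closedBall (Metric.ball_subset_closedBall hy), one_mul]
  have hzero : ∀ x ∉ tsupport g, g =ᶠ[nhds x] fun _ => 0 := fun x hx =>
    notMem_tsupport_iff_eventuallyEq.1 hx
  have key := LipschitzWith.integral_lineDeriv_mul_eq (μ := μ) hD hg hgc v
  rw [← integral_neg]
  convert key using 1
  · refine integral_congr_ae (Filter.Eventually.of_forall fun x => ?_)
    by_cases hx : x ∈ tsupport g
    · simp only
      rw [(hχf.differentiable one_ne_zero x).lineDeriv_eq_fderiv, (heq x hx).fderiv_eq]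
    · simp [(hzero x hx).eq_of_nhds]
  · refine integral_congr_ae (Filter.Eventually.of_forall fun x => ?_)
    by_cases hx : x ∈ tsupport g
    · simp only
      rw [lineDeriv_neg, (heq x hx).eq_of_nhds]; ring
    · have h0 : ∀ w, lineDeriv ℝ g x w = 0 := fun w => by
        rw [(hzero x hx).lineDeriv_eq]; simp [lineDeriv]
      simp [h0]

/-! ### The radial weight and its gradient -/

/-- The Lipschitz radial weight `max (1 / max |x - x₀| r - 1 / R) 0`. -/
noncomputable def radialCutoff (x₀ : E3) (r R : ℝ) (x : E3) : ℝ :=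
  max ((max ‖x - x₀‖ r)⁻¹ - R⁻¹) 0

section RadialCutoff

variable {x₀ : E3} {r R : ℝ}

theorem lipschitzWith_radialCutoff (hr : 0 < r) :
    ∃ C, LipschitzWith C (radialCutoff x₀ r R) := by
  have h1 : LipschitzWith 1 (fun x : E3 => max ‖x - x₀‖ r) := by
    refine LipschitzWith.max_const ?_ r
    refine LipschitzWith.of_dist_le_mul fun x y => ?_
    rw [NNReal.coe_one, one_mul, dist_eq_norm, Real.norm_eq_abs]
    refine (abs_norm_sub_norm_le _ _).trans ?_
    rw [dist_eq_norm]; simp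
  -- The map `s ↦ 1 / s` has slope at most `r⁻²` in absolute value on `s ≥ r`.
  refine ⟨NNReal.mk (r ^ 2)⁻¹ (by positivity), ?_⟩
  refine LipschitzWith.max_const (LipschitzWith.of_dist_le_mul fun x y => ?_) 0
  have ha : 0 < max ‖x - x₀‖ r := lt_max_of_lt_right hr
  have hb : 0 < max ‖y - x₀‖ r := lt_max_of_lt_right hr
  have h := h1.dist_le_mul x y
  rw [NNReal.coe_one, one_mul, Real.dist_eq] at h
  rw [Real.dist_eq, NNReal.coe_mk, sub_sub_sub_cancel_right, inv_sub_inv ha.ne' hb.ne', abs_div,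
    abs_of_pos (mul_pos ha hb), div_eq_inv_mul, abs_sub_comm]
  have h2 : r ^ 2 ≤ max ‖x - x₀‖ r * max ‖y - x₀‖ r := by
    rw [sq]; exact mul_le_mul (le_max_right _ _) (le_max_right _ _) hr.le ha.le
  gcongr

theorem radialCutoff_nonneg (x : E3) : 0 ≤ radialCutoff x₀ r R x := le_max_right _ _

theorem radialCutoff_le (hr : 0 < r) (hrR : r ≤ R) (x : E3) : radialCutoff x₀ r R x ≤ r⁻¹ := by
  refine max_le ?_ (by positivity)
  have : (max ‖x - x₀‖ r)⁻¹ ≤ r⁻¹ := inv_anti₀ hr (le_max_right _ _)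
  have : 0 ≤ R⁻¹ := inv_nonneg.2 (hr.le.trans hrR)
  linarith

theorem radialCutoff_of_mem_ball (hr : 0 < r) (hrR : r ≤ R) {x : E3} (hx : x ∈ Metric.ball x₀ r) :
    radialCutoff x₀ r R x = r⁻¹ - R⁻¹ := by
  rw [mem_ball_iff_norm] at hx
  rw [radialCutoff, max_eq_right hx.le, max_eq_left (sub_nonneg.2 (inv_anti₀ hr hrR))]

theorem radialCutoff_of_mem_annulus (hr : 0 < r) {x : E3}
    (hx : x ∈ Metric.ball x₀ R \ Metric.ball x₀ r) :
    radialCutoff x₀ r R x = ‖x - x₀‖⁻¹ - R⁻¹ := by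
  rw [Set.mem_sdiff, mem_ball_iff_norm, mem_ball_iff_norm, not_lt] at hx
  rw [radialCutoff, max_eq_left hx.2,
    max_eq_left (sub_nonneg.2 (inv_anti₀ (hr.trans_le hx.2) hx.1.le))]

theorem radialCutoff_of_notMem_ball (hr : 0 < r) (hrR : r ≤ R) {x : E3}
    (hx : x ∉ Metric.ball x₀ R) : radialCutoff x₀ r R x = 0 := by
  rw [mem_ball_iff_norm, not_lt] at hx
  rw [radialCutoff, max_eq_left (hrR.trans hx),
    max_eq_right (sub_nonpos.2 (inv_anti₀ (hr.trans_le hrR) hx))]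

theorem hasCompactSupport_radialCutoff (hr : 0 < r) (hrR : r ≤ R) :
    HasCompactSupport (radialCutoff x₀ r R) :=
  HasCompactSupport.intro (isCompact_closedBall x₀ R) fun _ hx =>
    radialCutoff_of_notMem_ball hr hrR fun h => hx (Metric.ball_subset_closedBall h)

theorem lineDeriv_radialCutoff (hr : 0 < r) (hrR : r ≤ R) {x : E3} (hxr : ‖x - x₀‖ ≠ r)
    (hxR : ‖x - x₀‖ ≠ R) (v : E3) :
    lineDeriv ℝ (radialCutoff x₀ r R) x v =
      -(Metric.ball x₀ R \ Metric.ball x₀ r).indicator (fun x => (‖x - x₀‖⁻¹) ^ 3 * ⟪x - x₀, v⟫) x := by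
  have hcont : Continuous fun x : E3 => ‖x - x₀‖ := by fun_prop
  rcases lt_or_gt_of_ne hxr with h | h
  · have : radialCutoff x₀ r R =ᶠ[nhds x] fun _ => r⁻¹ - R⁻¹ := by
      filter_upwards [(isOpen_lt hcont continuous_const).mem_nhds h] with y hy
      exact radialCutoff_of_mem_ball hr hrR (mem_ball_iff_norm.2 hy)
    rw [this.lineDeriv_eq, Set.indicator_of_notMem]
    · simp [lineDeriv]
    · simp [dist_eq_norm, h]
  rcases lt_or_gt_of_ne hxR with h' | h'
  · have h0 : x - x₀ ≠ 0 := norm_pos_iff.1 (hr.trans h)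
    have : radialCutoff x₀ r R =ᶠ[nhds x] fun y => ‖y - x₀‖⁻¹ - R⁻¹ := by
      filter_upwards [(isOpen_lt hcont continuous_const).mem_nhds h',
        (isOpen_lt continuous_const hcont).mem_nhds h] with y hy hy'
      exact radialCutoff_of_mem_annulus hr
        ⟨mem_ball_iff_norm.2 hy,
          fun h => lt_asymm hy' (mem_ball_iff_norm.1 h)⟩
    rw [this.lineDeriv_eq, Set.indicator_of_mem (by simp [dist_eq_norm, h', h.le])]
    have hline : HasDerivAt (fun t : ℝ => x + t • v - x₀) v 0 := by
      simpa using (((hasDerivAt_id (0 : ℝ)).smul_const v).const_add x).sub_const x₀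
    have hn : HasDerivAt (fun t : ℝ => ‖x + t • v - x₀‖ ^ 2) (2 * ⟪x - x₀, v⟫) 0 := by
      simpa using hline.norm_sq
    have hs := (hn.sqrt (by simpa using h0)).inv (by simpa using h0)
    simp only [Real.sqrt_sq (norm_nonneg _), zero_smul, add_zero] at hs
    refine ((HasDerivAt.congr_deriv (hs.sub_const R⁻¹) ?_).congr_of_eventuallyEq ?_).deriv
    · have := norm_ne_zero_iff.2 h0
      field_simp
    · exact Filter.Eventually.of_forall fun t => by simp
  · have : radialCutoff x₀ r R =ᶠ[nhds x] fun _ => 0 := by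
      filter_upwards [(isOpen_lt continuous_const hcont).mem_nhds h'] with y hy
      exact radialCutoff_of_notMem_ball hr hrR (by
        rw [mem_ball_iff_norm, not_lt]; exact le_of_lt hy)
    rw [this.lineDeriv_eq, Set.indicator_of_notMem]
    · simp [lineDeriv]
    · simp [dist_eq_norm, h'.le]

/-- The weight can have kinks only on the spheres of radii `r` and `R`, which are null sets. -/
theorem ae_lineDeriv_radialCutoff (hr : 0 < r) (hrR : r ≤ R) (v : E3) :
    ∀ᵐ x, lineDeriv ℝ (radialCutoff x₀ r R) x v =
      -(Metric.ball x₀ R \ Metric.ball x₀ r).indicator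
        (fun x => (‖x - x₀‖⁻¹) ^ 3 * ⟪x - x₀, v⟫) x := by
  have h : ∀ ρ : ℝ, ∀ᵐ x : E3, ‖x - x₀‖ ≠ ρ := fun ρ => by
    have := Measure.addHaar_sphere (volume : Measure E3) x₀ ρ
    rw [← compl_mem_ae_iff] at this
    filter_upwards [this] with x hx using by simpa [mem_sphere_iff_norm] using hx
  filter_upwards [h r, h R] with x h1 h2 using lineDeriv_radialCutoff hr hrR h1 h2 v

end RadialCutoff

/-! ### The Pohozaev identity for smooth maps -/

/-- The integrand of the Pohozaev identity for a solution of `Δd = g`, tested with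
`radialCutoff x₀ r R x • (x - x₀)`. -/
noncomputable def pohozaevIntegrand (ε : ℝ) (x₀ : E3) (r R : ℝ) (d : E3 → E3) (G : Fin 3 → E3 → E3)
    (g : E3 → E3) (x : E3) : ℝ :=
  radialCutoff x₀ r R x *
      (⟪g x + (1 / ε ^ 2 * (1 - ‖d x‖ ^ 2)) • d x, dirDeriv G (x - x₀) x⟫ - energyDensity ε d G x)
    - (Metric.ball x₀ R \ Metric.ball x₀ r).indicator (fun x => (‖x - x₀‖⁻¹) ^ 3 *
        (‖dirDeriv G (x - x₀) x‖ ^ 2 - ‖x - x₀‖ ^ 2 *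
          (1 / 2 * gradSq G x + 1 / (4 * ε ^ 2) * (1 - ‖d x‖ ^ 2) ^ 2))) x

/-- The partial derivative of a vector-valued function. -/
noncomputable def vecPartial (i : Fin 3) (v : E3 → E3) (x : E3) : E3 :=
  fderiv ℝ v x (EuclideanSpace.single i 1)

theorem contDiff_vecPartial {v : E3 → E3} (hv : ContDiff ℝ ∞ v) (i : Fin 3) :
    ContDiff ℝ ∞ (vecPartial i v) :=
  (hv.fderiv_right (m := ∞) (by simp)).clm_apply contDiff_const

theorem vecPartial_comm {v : E3 → E3} (hv : ContDiff ℝ ∞ v) (i j : Fin 3) (x : E3) :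
    vecPartial i (vecPartial j v) x = vecPartial j (vecPartial i v) x := by
  have hd : DifferentiableAt ℝ (fderiv ℝ v) x :=
    ((hv.fderiv_right (m := ∞) (by simp)).differentiable (by simp)) x
  have h : ∀ i j : Fin 3, vecPartial i (vecPartial j v) x =
      fderiv ℝ (fderiv ℝ v) x (EuclideanSpace.single i 1) (EuclideanSpace.single j 1) := by
    intro i j
    rw [vecPartial]
    have : vecPartial j v = fun x => fderiv ℝ v x (EuclideanSpace.single j 1) := rfl
    rw [this, fderiv_clm_apply hd (by fun_prop)]
    simp
  rw [h, h]
  exact (hv.contDiffAt.isSymmSndFDerivAt (by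
    simp only [minSmoothness_of_isRCLikeNormedField]
    exact WithTop.coe_le_coe.2 le_top)) _ _

/-- The `i`-th component of the stress-energy tensor applied to `x - x₀`. -/
noncomputable def stressFlux (ε : ℝ) (x₀ : E3) (v : E3 → E3) (i : Fin 3) (x : E3) : ℝ :=
  ⟪vecPartial i v x, dirDeriv (fun j => vecPartial j v) (x - x₀) x⟫ - (x - x₀) i *
    (1 / 2 * gradSq (fun j => vecPartial j v) x + 1 / (4 * ε ^ 2) * (1 - ‖v x‖ ^ 2) ^ 2)

theorem contDiff_stressFlux {v : E3 → E3} (hv : ContDiff ℝ ∞ v) (ε : ℝ) (x₀ : E3) (i : Fin 3) :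
    ContDiff ℝ ∞ (stressFlux ε x₀ v i) := by
  have hp := contDiff_vecPartial hv
  have hc : ∀ j : Fin 3, ContDiff ℝ ∞ fun x : E3 => (x - x₀) j := fun j =>
    (EuclideanSpace.proj (𝕜 := ℝ) j).contDiff.comp (contDiff_id.sub contDiff_const)
  unfold stressFlux dirDeriv gradSq
  refine ((hp i).inner ℝ (ContDiff.sum fun j _ => (hc j).smul (hp j))).sub ((hc i).mul ?_)
  refine (contDiff_const.mul (ContDiff.sum fun j _ => (hp j).norm_sq ℝ)).add
    (contDiff_const.mul ((contDiff_const.sub (hv.norm_sq ℝ)).pow 2))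

theorem fderiv_stressFlux {v : E3 → E3} (hv : ContDiff ℝ ∞ v) (ε : ℝ) (x₀ : E3) (i : Fin 3)
    (x : E3) :
    fderiv ℝ (stressFlux ε x₀ v i) x (EuclideanSpace.single i 1) =
      ⟪vecPartial i (vecPartial i v) x, dirDeriv (fun j => vecPartial j v) (x - x₀) x⟫
        + ‖vecPartial i v x‖ ^ 2
        + ∑ j, (x - x₀) j * ⟪vecPartial i v x, vecPartial i (vecPartial j v) x⟫
        - (1 / 2 * gradSq (fun j => vecPartial j v) x + 1 / (4 * ε ^ 2) * (1 - ‖v x‖ ^ 2) ^ 2)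
        - (x - x₀) i * (∑ j, ⟪vecPartial j v x, vecPartial i (vecPartial j v) x⟫
          - 1 / ε ^ 2 * (1 - ‖v x‖ ^ 2) * ⟪v x, vecPartial i v x⟫) := by
  -- Restricting to the line `t ↦ x + t eᵢ` reduces the computation to one-variable product rules.
  have hd : ∀ w : E3 → E3, ContDiff ℝ ∞ w →
      HasDerivAt (fun t : ℝ => w (x + t • EuclideanSpace.single i 1)) (vecPartial i w x) 0 :=
    fun w hw => ((hw.differentiable (by simp) x).hasFDerivAt.hasLineDerivAt _)
  have hp := fun j => hd _ (contDiff_vecPartial hv j)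
  have hline : HasDerivAt (fun t : ℝ => x + t • EuclideanSpace.single i (1 : ℝ) - x₀)
      (EuclideanSpace.single i 1) 0 := by
    simpa using (((hasDerivAt_id (0 : ℝ)).smul_const
      (EuclideanSpace.single i (1 : ℝ))).const_add x).sub_const x₀
  have hy : ∀ j : Fin 3, HasDerivAt (fun t : ℝ => (x + t • EuclideanSpace.single i (1 : ℝ) - x₀) j)
      (if j = i then 1 else 0) 0 := fun j => by
    have h := (EuclideanSpace.proj (𝕜 := ℝ) j).hasFDerivAt.comp_hasDerivAt (0 : ℝ) hline
    refine h.congr_deriv ?_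
    simp
  have hflux := ((hp i).inner ℝ (HasDerivAt.fun_sum fun j (_ : j ∈ Finset.univ) =>
    (hy j).smul (hp j))).sub ((hy i).mul
      (((HasDerivAt.fun_sum fun j (_ : j ∈ Finset.univ) => (hp j).norm_sq).const_mul (1 / 2)).add
        ((((hd v hv).norm_sq.const_sub 1).pow 2).const_mul (1 / (4 * ε ^ 2)))))
  have hl := ((contDiff_stressFlux hv ε x₀ i).differentiable (by simp) x).hasFDerivAt.hasLineDerivAt
    (EuclideanSpace.single i (1 : ℝ))
  refine (HasDerivAt.unique hl hflux).trans ?_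
  simp only [zero_smul, add_zero, dirDeriv, gradSq, inner_add_right, inner_sum,
    inner_smul_right, Finset.sum_add_distrib,
    ite_smul, one_smul, zero_smul, Finset.sum_ite_eq',
    Finset.mem_univ, if_true,
    real_inner_self_eq_norm_sq, ← Finset.mul_sum, Pi.pow_apply,
    Pi.smul_apply']
  norm_num
  ring_nf

/-- Symmetry of second derivatives cancels the terms `yⱼ ⟨∂ᵢv, ∂ᵢ∂ⱼv⟩` against the derivative of
`½|∇v|²`. The divergence of `y` is 3, which leaves `|∇v|² - 3(½|∇v|² + W) = -e_ε(v)`;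
differentiating `W` supplies the nonlinear term. -/
theorem sum_fderiv_stressFlux {v : E3 → E3} (hv : ContDiff ℝ ∞ v) (ε : ℝ) (x₀ : E3) (x : E3) :
    ∑ i, fderiv ℝ (stressFlux ε x₀ v i) x (EuclideanSpace.single i 1) =
      ⟪(∑ i, vecPartial i (vecPartial i v) x) + (1 / ε ^ 2 * (1 - ‖v x‖ ^ 2)) • v x,
          dirDeriv (fun j => vecPartial j v) (x - x₀) x⟫
        - energyDensity ε v (fun j => vecPartial j v) x := by
  simp only [fderiv_stressFlux hv, Fin.sum_univ_three, energyDensity, gradSq, dirDeriv,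
    inner_add_left, inner_add_right, inner_smul_left, inner_smul_right,
    vecPartial_comm hv 1 0, vecPartial_comm hv 2 0, vecPartial_comm hv 2 1, conj_trivial]
  ring

theorem sum_mul_stressFlux (ε : ℝ) (x₀ : E3) (v : E3 → E3) (x : E3) :
    ∑ i, (x - x₀) i * stressFlux ε x₀ v i x =
      ‖dirDeriv (fun j => vecPartial j v) (x - x₀) x‖ ^ 2 - ‖x - x₀‖ ^ 2 *
        (1 / 2 * gradSq (fun j => vecPartial j v) x + 1 / (4 * ε ^ 2) * (1 - ‖v x‖ ^ 2) ^ 2) := by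
  rw [EuclideanSpace.real_norm_sq_eq (x - x₀), ← real_inner_self_eq_norm_sq]
  have h : ∀ w : E3, ⟪dirDeriv (fun j => vecPartial j v) (x - x₀) x, w⟫ =
      ∑ i, (x - x₀) i * ⟪vecPartial i v x, w⟫ := fun w => by
    simp only [dirDeriv, sum_inner, real_inner_smul_left]
  rw [h]
  simp only [stressFlux, mul_sub, Finset.sum_sub_distrib,
    Finset.sum_mul]
  congr 1
  exact Finset.sum_congr rfl fun i _ => by ring

/-- The source is the Laplacian of `v` itself, so this is an identity for every smooth map, and
mollifications, which do not solve the equation, are allowed. -/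
theorem integral_pohozaevIntegrand_of_contDiff {v : E3 → E3} (hv : ContDiff ℝ ∞ v) (ε : ℝ)
    (x₀ : E3) {r R : ℝ} (hr : 0 < r) (hrR : r ≤ R) :
    ∫ x, pohozaevIntegrand ε x₀ r R v (fun i => vecPartial i v)
      (fun x => ∑ i, vecPartial i (vecPartial i v) x) x = 0 := by
  set A := Metric.ball x₀ R \ Metric.ball x₀ r with hA
  have hAm : MeasurableSet A := measurableSet_ball.diff measurableSet_ball
  obtain ⟨C, hC⟩ := lipschitzWith_radialCutoff (x₀ := x₀) (R := R) hr
  have hcs := hasCompactSupport_radialCutoff (x₀ := x₀) hr hrR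
  have hZ := contDiff_stressFlux hv ε x₀
  have hI1 : ∀ i, Integrable fun x => fderiv ℝ (stressFlux ε x₀ v i) x (EuclideanSpace.single i 1) *
      radialCutoff x₀ r R x := fun i =>
    (((hZ i).continuous_fderiv_apply (by simp)).comp
      (continuous_id.prodMk continuous_const) |>.mul hC.continuous).integrable_of_hasCompactSupport
      hcs.mul_left
  have hI2 : ∀ i, Integrable (A.indicator fun x =>
      (‖x - x₀‖⁻¹) ^ 3 * ((x - x₀) i * stressFlux ε x₀ v i x)) := by
    intro i
    rw [integrable_indicator_iff hAm]
    have hK : IsCompact (Metric.closedBall x₀ R \ Metric.ball x₀ r) :=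
      (isCompact_closedBall x₀ R).diff Metric.isOpen_ball
    refine (ContinuousOn.integrableOn_compact hK ?_).mono_set
      (Set.sdiff_subset_sdiff_left Metric.ball_subset_closedBall)
    refine ContinuousOn.mul (ContinuousOn.pow (ContinuousOn.inv₀ (by fun_prop) ?_) 3)
      (Continuous.continuousOn (Continuous.mul (by fun_prop) (hZ i).continuous))
    intro x hx h
    apply hx.2
    rw [mem_ball_iff_norm, h]
    exact hr
  have hparts : ∀ i, ∫ x, fderiv ℝ (stressFlux ε x₀ v i) x (EuclideanSpace.single i 1) *
      radialCutoff x₀ r R x = ∫ x, A.indicator (fun x =>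
      (‖x - x₀‖⁻¹) ^ 3 * ((x - x₀) i * stressFlux ε x₀ v i x)) x := by
    intro i
    rw [integral_fderiv_mul_eq_neg_lineDeriv_mul ((hZ i).of_le (by simp)) hC hcs, ← integral_neg]
    refine integral_congr_ae ?_
    filter_upwards [ae_lineDeriv_radialCutoff (x₀ := x₀) hr hrR (EuclideanSpace.single i 1)] with x hx
    simp only [hx, ← hA]
    by_cases h : x ∈ A
    · have hin : ⟪x - x₀, EuclideanSpace.single i (1 : ℝ)⟫ = (x - x₀) i := by
        simp [EuclideanSpace.inner_single_right]
      simp only [Set.indicator_of_mem h, hin]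
      ring
    · simp [h]
  have hsum : ∀ x, pohozaevIntegrand ε x₀ r R v (fun i => vecPartial i v)
      (fun x => ∑ i, vecPartial i (vecPartial i v) x) x =
      ∑ i, (fderiv ℝ (stressFlux ε x₀ v i) x (EuclideanSpace.single i 1) * radialCutoff x₀ r R x -
        A.indicator (fun x => (‖x - x₀‖⁻¹) ^ 3 * ((x - x₀) i * stressFlux ε x₀ v i x)) x) := by
    intro x
    rw [Finset.sum_sub_distrib, ← Finset.sum_mul, sum_fderiv_stressFlux hv, mul_comm,
      pohozaevIntegrand, ← hA]
    congr 1
    by_cases h : x ∈ A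
    · simp only [Set.indicator_of_mem h, ← Finset.mul_sum, sum_mul_stressFlux]
    · simp [h]
  simp only [hsum]
  refine (integral_finsetSum _ fun i _ => (hI1 i).sub (hI2 i)).trans ?_
  refine Finset.sum_eq_zero fun i _ => ?_
  exact (integral_sub (hI1 i) (hI2 i)).trans (by rw [hparts, sub_self])

/-! ### Mollification -/

open scoped Convolution

section Mollify

variable {F : Type*} [NormedAddCommGroup F] [NormedSpace ℝ F]

/-- The mollification of `h` by a normalized bump function. -/
noncomputable def mollify (φ : ContDiffBump (0 : E3)) (h : E3 → F) : E3 → F :=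
  φ.normed volume ⋆[ContinuousLinearMap.lsmul ℝ ℝ, volume] h

variable (φ : ContDiffBump (0 : E3))

theorem mollify_apply (h : E3 → F) (x : E3) :
    mollify φ h x = ∫ t, φ.normed volume (x - t) • h t := by
  rw [mollify, convolution_eq_swap]; rfl

theorem contDiff_normed_infty : ContDiff ℝ ∞ (φ.normed (volume : Measure E3)) :=
  φ.contDiff_normed

theorem integrable_kernel_smul {k : E3 → ℝ} (hk : Continuous k) (hkc : HasCompactSupport k)
    {h : E3 → F} (hh : LocallyIntegrable h) (x : E3) : Integrable fun t => k (x - t) • h t := by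
  have := (hkc.convolutionExists_left (ContinuousLinearMap.lsmul ℝ ℝ) hk hh x).integrable_swap
  exact this

theorem integrable_normed_smul {h : E3 → F} (hh : LocallyIntegrable h) (x : E3) :
    Integrable fun t => φ.normed volume (x - t) • h t :=
  integrable_kernel_smul φ.continuous_normed φ.hasCompactSupport_normed hh x

theorem integral_normed_sub (x : E3) : ∫ t, φ.normed (volume : Measure E3) (x - t) = 1 := by
  rw [integral_sub_left_eq_self (fun t => φ.normed (volume : Measure E3) t)]
  exact φ.integral_normed

theorem integrable_normed_sub (x : E3) : Integrable fun t => φ.normed (volume : Measure E3) (x - t) :=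
  φ.integrable_normed.comp_sub_left x

theorem contDiff_mollify [CompleteSpace F] {h : E3 → F} (hh : LocallyIntegrable h) : ContDiff ℝ ∞ (mollify φ h) :=
  φ.hasCompactSupport_normed.contDiff_convolution_left _ (contDiff_normed_infty φ) hh

theorem norm_mollify_le_one {h : E3 → F} (hh : ∀ᵐ t, ‖h t‖ ≤ 1) (x : E3) :
    ‖mollify φ h x‖ ≤ 1 := by
  rw [mollify_apply, ← integral_normed_sub φ x]
  refine norm_integral_le_of_norm_le (integrable_normed_sub φ x) ?_
  filter_upwards [hh] with t ht
  rw [norm_smul, Real.norm_of_nonneg (φ.nonneg_normed _)]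
  exact mul_le_of_le_one_right (φ.nonneg_normed _) ht

/-- Jensen's inequality for the probability density `φ(x - ·)`, obtained by integrating `(‖h‖ - c)²
≥ 0` with `c` the norm of the mean. -/
theorem norm_mollify_sq_le {h : E3 → F} (hh : LocallyIntegrable h)
    (hh2 : LocallyIntegrable fun t => ‖h t‖ ^ 2) (x : E3) :
    ‖mollify φ h x‖ ^ 2 ≤ mollify φ (fun t => ‖h t‖ ^ 2) x := by
  set c := ‖mollify φ h x‖ with hc
  have hI := integrable_normed_smul φ hh x
  have hI2 := integrable_normed_smul φ hh2 x
  have h1 : c ≤ ∫ t, φ.normed volume (x - t) * ‖h t‖ := by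
    rw [hc, mollify_apply]
    refine (norm_integral_le_integral_norm _).trans_eq ?_
    simp only [norm_smul, Real.norm_of_nonneg (φ.nonneg_normed _)]
  have h2 : 2 * c * (∫ t, φ.normed volume (x - t) * ‖h t‖) ≤
      mollify φ (fun t => ‖h t‖ ^ 2) x + c ^ 2 := by
    have hr : c ^ 2 = ∫ t, φ.normed volume (x - t) * c ^ 2 := by
      rw [integral_mul_const, integral_normed_sub, one_mul]
    rw [mollify_apply, hr, ← integral_const_mul, ← integral_add hI2
      ((integrable_normed_sub φ x).mul_const _)]
    refine integral_mono ?_ (hI2.add ((integrable_normed_sub φ x).mul_const _)) fun t => ?_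
    · refine Integrable.const_mul ?_ _
      simpa only [norm_smul, Real.norm_of_nonneg (φ.nonneg_normed _)] using hI.norm
    · simp only [smul_eq_mul]
      nlinarith [mul_nonneg (φ.nonneg_normed (μ := volume) (x - t)) (sq_nonneg (‖h t‖ - c))]
  nlinarith [norm_nonneg (mollify φ h x)]

theorem integrable_mollify {k : E3 → ℝ} (hk : Integrable k) : Integrable (mollify φ k) :=
  φ.integrable_normed.integrable_convolution _ hk

theorem integral_mollify {k : E3 → ℝ} (hk : Integrable k) : ∫ x, mollify φ k x = ∫ x, k x := by
  rw [mollify, integral_convolution _ φ.integrable_normed hk, φ.integral_normed]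
  simp

end Mollify

theorem vecPartial_mollify (φ : ContDiffBump (0 : E3)) {h : E3 → E3} (hh : LocallyIntegrable h)
    (i : Fin 3) (x : E3) :
    vecPartial i (mollify φ h) x =
      ∫ t, partialDeriv i (φ.normed volume) (x - t) • h t := by
  have h1 : ContDiff ℝ 1 (φ.normed (volume : Measure E3)) := (contDiff_normed_infty φ).of_le (by simp)
  rw [vecPartial, mollify, (φ.hasCompactSupport_normed.hasFDerivAt_convolution_left _ h1 hh x).fderiv,
    convolution_eq_swap]
  have hc : HasCompactSupport (fderiv ℝ (φ.normed (volume : Measure E3))) :=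
    φ.hasCompactSupport_normed.fderiv ℝ
  rw [ContinuousLinearMap.integral_apply]
  · rfl
  · have hE : ConvolutionExistsAt (fderiv ℝ (φ.normed (volume : Measure E3))) h x
        ((ContinuousLinearMap.lsmul ℝ ℝ : ℝ →L[ℝ] E3 →L[ℝ] E3).precompL E3) volume :=
      HasCompactSupport.convolutionExists_left _ hc (h1.continuous_fderiv one_ne_zero) hh x
    exact hE.integrable_swap

theorem partialDeriv_comp_sub_left {ρ : E3 → ℝ} (hρ : Differentiable ℝ ρ) (i : Fin 3) (x t : E3) :
    partialDeriv i (fun t => ρ (x - t)) t = -partialDeriv i ρ (x - t) := by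
  rw [partialDeriv, partialDeriv]
  have h := (hρ (x - t)).hasFDerivAt.comp t ((hasFDerivAt_id t).const_sub x)
  have h' : fderiv ℝ (fun t => ρ (x - t)) t = _ := h.fderiv
  rw [h']
  simp

theorem isTestFunction_normed_sub (φ : ContDiffBump (0 : E3)) {Ω : Set E3} {x : E3}
    (hx : Metric.closedBall x φ.rOut ⊆ Ω) :
    IsTestFunction Ω (fun t => φ.normed volume (x - t)) := by
  have hs : tsupport (fun t => φ.normed volume (x - t)) ⊆ Metric.closedBall x φ.rOut := by
    refine closure_minimal (fun t ht => ?_) Metric.isClosed_closedBall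
    have : x - t ∈ Function.support (φ.normed (volume : Measure E3)) := ht
    rw [φ.support_normed_eq, mem_ball_zero_iff] at this
    rw [Metric.mem_closedBall, dist_comm, dist_eq_norm]
    exact this.le
  exact ⟨(contDiff_normed_infty φ).comp (contDiff_const.sub contDiff_id),
    (isCompact_closedBall x φ.rOut).of_isClosed_subset (isClosed_tsupport _) hs, hs.trans hx⟩

/-! ### Mollified weak derivatives and the mollified equation -/

section WeakDerivatives

variable {Ω : Set E3} {φ : ContDiffBump (0 : E3)} {x : E3}

theorem integral_smul_indicator (hΩ : MeasurableSet Ω) (k : E3 → ℝ) (h : E3 → E3) :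
    ∫ t, k t • Ω.indicator h t = ∫ t in Ω, k t • h t := by
  rw [← integral_indicator hΩ]
  congr 1 with t
  by_cases ht : t ∈ Ω <;> simp [ht]

/-- The kernel `t ↦ φ(x - t)` is an admissible test function once its support fits in `Ω`. The sign
from differentiating in `t` instead of `x` cancels the one in the weak derivative. -/
theorem vecPartial_mollify_indicator (hΩ : MeasurableSet Ω) {i : Fin 3} {d g : E3 → E3}
    (hw : HasWeakPartialDeriv Ω i d g) (hd : LocallyIntegrable (Ω.indicator d))
    (hx : Metric.closedBall x φ.rOut ⊆ Ω) :
    vecPartial i (mollify φ (Ω.indicator d)) x = mollify φ (Ω.indicator g) x := by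
  have h := hw.integral_eq _ (isTestFunction_normed_sub φ hx)
  simp only [partialDeriv_comp_sub_left ((contDiff_normed_infty φ).differentiable (by simp)), neg_smul,
    integral_neg, neg_inj] at h
  rw [vecPartial_mollify φ hd, mollify_apply, integral_smul_indicator hΩ, integral_smul_indicator hΩ,
    h]

theorem sum_vecPartial_mollify_indicator (hΩ : MeasurableSet Ω) {ε : ℝ} {d τ : E3 → E3}
    {G : Fin 3 → E3 → E3} (hsol : IsWeakSolutionAGL Ω ε d G τ)
    (hG : ∀ i, LocallyIntegrable (Ω.indicator (G i)))
    (hN : LocallyIntegrable (Ω.indicator fun x => (1 / ε ^ 2 * (1 - ‖d x‖ ^ 2)) • d x))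
    (hτ : LocallyIntegrable (Ω.indicator τ))
    (hx : Metric.closedBall x φ.rOut ⊆ Ω) :
    ∑ i, vecPartial i (mollify φ (Ω.indicator (G i))) x =
      mollify φ (Ω.indicator fun x => τ x - (1 / ε ^ 2 * (1 - ‖d x‖ ^ 2)) • d x) x := by
  have h := hsol _ (isTestFunction_normed_sub φ hx)
  have hρ := contDiff_normed_infty φ
  have hint : ∀ i, Integrable fun t =>
      partialDeriv i (φ.normed volume) (x - t) • Ω.indicator (G i) t := fun i =>
    integrable_kernel_smul ((hρ.continuous_fderiv_apply (by simp)).comp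
      (continuous_id.prodMk continuous_const)) (φ.hasCompactSupport_normed.fderiv_apply ℝ _) (hG i) x
  have hsum : ∫ t in Ω, ∑ i, partialDeriv i (fun t => φ.normed volume (x - t)) t • G i t =
      -∑ i, vecPartial i (mollify φ (Ω.indicator (G i))) x := by
    simp only [vecPartial_mollify φ (hG _)]
    rw [← integral_finsetSum _ fun i _ => hint i, ← integral_neg, ← integral_indicator hΩ]
    congr 1 with t : 1
    by_cases ht : t ∈ Ω
    · simp [ht, partialDeriv_comp_sub_left (hρ.differentiable (by simp))]
    · simp [ht]
  rw [hsum, neg_neg] at h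
  rw [eq_sub_of_add_eq h, mollify_apply, ← integral_smul_indicator hΩ, ← integral_smul_indicator hΩ,
    ← integral_sub (integrable_normed_smul φ hτ x) (integrable_normed_smul φ hN x)]
  congr 1 with t : 1
  by_cases ht : t ∈ Ω
  · simp [ht, smul_sub]
  · simp [ht]

end WeakDerivatives

/-! ### Dominated convergence with varying majorants -/

theorem tendsto_integral_of_tendsto_dominating {α : Type*} [MeasurableSpace α] {μ : Measure α}
    {F D : ℕ → α → ℝ} {f g : α → ℝ} (hF : ∀ n, AEStronglyMeasurable (F n) μ)
    (hD : ∀ n, Integrable (D n) μ) (hg : Integrable g μ) (hbound : ∀ n, ∀ᵐ x ∂μ, |F n x| ≤ D n x)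
    (hDg : ∀ᵐ x ∂μ, Filter.Tendsto (fun n => D n x) Filter.atTop (nhds (g x)))
    (hFf : ∀ᵐ x ∂μ, Filter.Tendsto (fun n => F n x) Filter.atTop (nhds (f x)))
    (hint : Filter.Tendsto (fun n => ∫ x, D n x ∂μ) Filter.atTop (nhds (∫ x, g x ∂μ))) :
    Filter.Tendsto (fun n => ∫ x, F n x ∂μ) Filter.atTop (nhds (∫ x, f x ∂μ)) := by
  have hbound' := ae_all_iff.2 hbound
  have hfg : ∀ᵐ x ∂μ, |f x| ≤ g x := by
    filter_upwards [hbound', hDg, hFf] with x h1 h2 h3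
    exact le_of_tendsto_of_tendsto' h3.abs h2 h1
  -- Clipping `F n` to `[-g, g]` gives a sequence with the fixed majorant `g`.
  have hclip : Filter.Tendsto (fun n => ∫ x, max (-g x) (min (F n x) (g x)) ∂μ) Filter.atTop
      (nhds (∫ x, f x ∂μ)) := by
    refine tendsto_integral_of_dominated_convergence g (fun n => ?_) hg (fun n => ?_) ?_
    · exact hg.aestronglyMeasurable.neg.sup ((hF n).inf hg.aestronglyMeasurable)
    · filter_upwards [hfg] with x hx
      have h0 := (abs_nonneg _).trans hx
      rw [Real.norm_eq_abs, abs_le]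
      exact ⟨le_max_left _ _, max_le (by linarith) (min_le_right _ _)⟩
    · filter_upwards [hfg, hFf] with x hx h
      have := (tendsto_const_nhds (x := -g x)).max (h.min (tendsto_const_nhds (x := g x)))
      rwa [min_eq_left (le_of_abs_le hx), max_eq_right (neg_le_of_abs_le hx)] at this
  have hmin : Filter.Tendsto (fun n => ∫ x, min (D n x) (g x) ∂μ) Filter.atTop
      (nhds (∫ x, g x ∂μ)) := by
    refine tendsto_integral_of_dominated_convergence g (fun n => ?_) hg (fun n => ?_) ?_
    · exact (hD n).aestronglyMeasurable.inf hg.aestronglyMeasurable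
    · filter_upwards [hfg, hbound n] with x hx hx'
      rw [Real.norm_of_nonneg (le_min ((abs_nonneg _).trans hx') ((abs_nonneg _).trans hx))]
      exact min_le_right _ _
    · filter_upwards [hDg] with x h
      simpa using h.min (tendsto_const_nhds (x := g x))
  have hFint : ∀ n, Integrable (F n) μ := fun n => (hD n).mono' (hF n) (hbound n)
  have hcint : ∀ n, Integrable (fun x => max (-g x) (min (F n x) (g x))) μ := fun n =>
    hg.neg.sup ((hFint n).inf hg)
  have hdiff : Filter.Tendsto
      (fun n => (∫ x, F n x ∂μ) - ∫ x, max (-g x) (min (F n x) (g x)) ∂μ) Filter.atTop (nhds 0) := by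
    -- The clipping error is at most `(D n - g)₊ = D n - min (D n) g`, whose integral tends to 0.
    refine squeeze_zero_norm (a := fun n => (∫ x, D n x ∂μ) - ∫ x, min (D n x) (g x) ∂μ)
      (fun n => ?_) (by simpa using hint.sub hmin)
    have hm : Integrable (fun x => min (D n x) (g x)) μ := (hD n).inf hg
    rw [← integral_sub (hFint n) (hcint n), ← integral_sub (hD n) hm]
    refine norm_integral_le_of_norm_le ((hD n).sub hm) ?_
    filter_upwards [hfg, hbound n] with x hx hx'
    have h0 := (abs_nonneg _).trans hx
    rw [abs_le] at hx'
    rw [Real.norm_eq_abs, abs_le]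
    rcases max_cases (-g x) (min (F n x) (g x)) with ⟨h1, _⟩ | ⟨h1, _⟩ <;>
    rcases min_cases (F n x) (g x) with ⟨h2, _⟩ | ⟨h2, _⟩ <;>
    rcases min_cases (D n x) (g x) with ⟨h3, _⟩ | ⟨h3, _⟩ <;>
    rw [h1, h3] <;> constructor <;> linarith [hx'.1, hx'.2]
  simpa using hdiff.add hclip

/-! ### Bounds, measurability and continuity of the Pohozaev integrand -/

theorem dirDeriv_smul (G : Fin 3 → E3 → E3) (c : ℝ) (v x : E3) :
    dirDeriv G (c • v) x = c • dirDeriv G v x := by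
  simp [dirDeriv, Finset.smul_sum, smul_smul]

theorem norm_dirDeriv_sq_le (G : Fin 3 → E3 → E3) (v x : E3) :
    ‖dirDeriv G v x‖ ^ 2 ≤ ‖v‖ ^ 2 * gradSq G x := by
  have h1 : ‖dirDeriv G v x‖ ≤ ∑ i, ‖v i‖ * ‖G i x‖ :=
    (norm_sum_le _ _).trans_eq (Finset.sum_congr rfl fun i _ => norm_smul _ _)
  rw [EuclideanSpace.norm_sq_eq v, gradSq]
  exact (pow_le_pow_left₀ (norm_nonneg _) h1 2).trans (Finset.sum_mul_sq_le_sq_mul_sq _ _ _)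

theorem gradSq_nonneg (G : Fin 3 → E3 → E3) (x : E3) : 0 ≤ gradSq G x :=
  Finset.sum_nonneg fun _ _ => sq_nonneg _

section PohozaevIntegrand

variable {ε : ℝ} {x₀ : E3} {r R : ℝ} {d : E3 → E3} {G : Fin 3 → E3 → E3} {g : E3 → E3}

theorem pohozaevIntegrand_of_notMem (hr : 0 < r) (hrR : r ≤ R) {x : E3}
    (hx : x ∉ Metric.ball x₀ R) : pohozaevIntegrand ε x₀ r R d G g x = 0 := by
  rw [pohozaevIntegrand, radialCutoff_of_notMem_ball hr hrR hx,
    Set.indicator_of_notMem fun h => hx h.1]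
  simp

theorem pohozaevIntegrand_congr (hr : 0 < r) (hrR : r ≤ R) {d' : E3 → E3} {G' : Fin 3 → E3 → E3}
    {g' : E3 → E3} {x : E3}
    (h : x ∈ Metric.ball x₀ R → d x = d' x ∧ (∀ i, G i x = G' i x) ∧ g x = g' x) :
    pohozaevIntegrand ε x₀ r R d G g x = pohozaevIntegrand ε x₀ r R d' G' g' x := by
  by_cases hx : x ∈ Metric.ball x₀ R
  · obtain ⟨h1, h2, h3⟩ := h hx
    simp only [pohozaevIntegrand, energyDensity, dirDeriv, gradSq, Set.indicator, h1, h2, h3]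
  · rw [pohozaevIntegrand_of_notMem hr hrR hx, pohozaevIntegrand_of_notMem hr hrR hx]

/-- The weight is at most `r⁻¹`, and on the annulus `|y|⁻³ |y|² ≤ r⁻¹`. Young's inequality handles
the inner product; the constant is a crude common bound for all coefficients. -/
theorem abs_pohozaevIntegrand_le (hr : 0 < r) (hrR : r ≤ R) {x : E3} (hd : ‖d x‖ ≤ 1) :
    |pohozaevIntegrand ε x₀ r R d G g x| ≤ r⁻¹ * (3 + R ^ 2 + 1 / ε ^ 2 + (1 / ε ^ 2) ^ 2) *
      ((Metric.ball x₀ R).indicator (fun _ => 1) x + (gradSq G x + ‖g x‖ ^ 2)) := by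
  have hS := gradSq_nonneg G x
  by_cases hx : x ∈ Metric.ball x₀ R
  swap
  · rw [pohozaevIntegrand_of_notMem hr hrR hx, Set.indicator_of_notMem hx, abs_zero]
    positivity
  rw [Set.indicator_of_mem hx]
  have hxR : ‖x - x₀‖ < R := mem_ball_iff_norm.1 hx
  have hf0 : 0 ≤ 1 - ‖d x‖ ^ 2 := by nlinarith [norm_nonneg (d x)]
  have hf1 : 1 - ‖d x‖ ^ 2 ≤ 1 := by nlinarith [norm_nonneg (d x)]
  have hD := norm_dirDeriv_sq_le G (x - x₀) x
  have hDR : ‖dirDeriv G (x - x₀) x‖ ^ 2 ≤ R ^ 2 * gradSq G x :=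
    hD.trans (mul_le_mul_of_nonneg_right (pow_le_pow_left₀ (norm_nonneg _) hxR.le 2) hS)
  set S := gradSq G x
  set D := dirDeriv G (x - x₀) x
  set k := 1 / ε ^ 2 with hk
  have hk0 : 0 ≤ k := by positivity
  have hk4 : 1 / (4 * ε ^ 2) = k / 4 := by rw [hk]; ring
  have hk3 : 3 / (4 * ε ^ 2) = 3 * k / 4 := by rw [hk]; ring
  have hW0 : 0 ≤ k * (1 - ‖d x‖ ^ 2) ^ 2 := by positivity
  have hW1 : k * (1 - ‖d x‖ ^ 2) ^ 2 ≤ k := mul_le_of_le_one_right hk0 (pow_le_one₀ hf0 hf1)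
  have hN : ‖(k * (1 - ‖d x‖ ^ 2)) • d x‖ ≤ k := by
    rw [norm_smul, Real.norm_of_nonneg (by positivity), mul_assoc]
    exact mul_le_of_le_one_right hk0 (mul_le_one₀ hf1 (norm_nonneg _) hd)
  have hin : |⟪g x + (k * (1 - ‖d x‖ ^ 2)) • d x, D⟫| ≤ ‖g x‖ ^ 2 + k ^ 2 + R ^ 2 * S / 2 := by
    refine (abs_real_inner_le_norm _ _).trans ?_
    have h1 : ‖g x + (k * (1 - ‖d x‖ ^ 2)) • d x‖ ≤ ‖g x‖ + k :=
      (norm_add_le _ _).trans (by gcongr)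
    have h2 : ‖g x + (k * (1 - ‖d x‖ ^ 2)) • d x‖ ^ 2 ≤ (‖g x‖ + k) ^ 2 :=
      pow_le_pow_left₀ (norm_nonneg _) h1 2
    nlinarith [sq_nonneg (‖g x + (k * (1 - ‖d x‖ ^ 2)) • d x‖ - ‖D‖), sq_nonneg (‖g x‖ - k)]
  have hfirst : |radialCutoff x₀ r R x *
      (⟪g x + (k * (1 - ‖d x‖ ^ 2)) • d x, D⟫ - energyDensity ε d G x)| ≤
      r⁻¹ * (‖g x‖ ^ 2 + k ^ 2 + R ^ 2 * S / 2 + (S / 2 + 3 * k / 4)) := by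
    rw [abs_mul, abs_of_nonneg (radialCutoff_nonneg x)]
    refine mul_le_mul (radialCutoff_le hr hrR x) ((abs_sub _ _).trans (add_le_add hin ?_))
      (abs_nonneg _) (by positivity)
    rw [energyDensity, hk3, abs_of_nonneg (by positivity)]
    linarith
  have hsecond : |(Metric.ball x₀ R \ Metric.ball x₀ r).indicator (fun x => (‖x - x₀‖⁻¹) ^ 3 *
        (‖dirDeriv G (x - x₀) x‖ ^ 2 - ‖x - x₀‖ ^ 2 *
          (1 / 2 * gradSq G x + 1 / (4 * ε ^ 2) * (1 - ‖d x‖ ^ 2) ^ 2))) x| ≤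
      r⁻¹ * (S + (S / 2 + k / 4)) := by
    by_cases hA : x ∈ Metric.ball x₀ R \ Metric.ball x₀ r
    · rw [Set.indicator_of_mem hA]
      have hxr : r ≤ ‖x - x₀‖ := not_lt.1 fun h => hA.2 (mem_ball_iff_norm.2 h)
      have hy : 0 < ‖x - x₀‖ := hr.trans_le hxr
      have hE : |‖D‖ ^ 2 - ‖x - x₀‖ ^ 2 * (1 / 2 * S + 1 / (4 * ε ^ 2) * (1 - ‖d x‖ ^ 2) ^ 2)| ≤
          ‖x - x₀‖ ^ 2 * (S + (S / 2 + k / 4)) := by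
        refine (abs_sub _ _).trans ?_
        rw [mul_add _ S]
        refine add_le_add ((abs_of_nonneg (sq_nonneg _)).trans_le hD) ?_
        rw [hk4, abs_of_nonneg (by positivity)]
        exact mul_le_mul_of_nonneg_left (by linarith) (sq_nonneg _)
      rw [abs_mul, abs_of_nonneg (by positivity)]
      calc (‖x - x₀‖⁻¹) ^ 3 * _ ≤ (‖x - x₀‖⁻¹) ^ 3 * (‖x - x₀‖ ^ 2 * (S + (S / 2 + k / 4))) :=
            mul_le_mul_of_nonneg_left hE (by positivity)
        _ = ‖x - x₀‖⁻¹ * (S + (S / 2 + k / 4)) := by field_simp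
        _ ≤ r⁻¹ * (S + (S / 2 + k / 4)) :=
            mul_le_mul_of_nonneg_right (inv_anti₀ hr hxr) (by positivity)
    · rw [Set.indicator_of_notMem hA, abs_zero]
      positivity
  rw [pohozaevIntegrand]
  refine ((abs_sub _ _).trans (add_le_add hfirst hsecond)).trans ?_
  rw [mul_assoc, ← mul_add]
  refine mul_le_mul_of_nonneg_left ?_ (by positivity)
  nlinarith [mul_nonneg (sq_nonneg R) (sq_nonneg ‖g x‖), mul_nonneg hk0 (sq_nonneg ‖g x‖),
    mul_nonneg hk0 hS, mul_nonneg (sq_nonneg k) hS, mul_nonneg (sq_nonneg k) (sq_nonneg ‖g x‖),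
    mul_nonneg (sq_nonneg R) hS, sq_nonneg ‖g x‖, sq_nonneg R]

theorem aestronglyMeasurable_gradSq {μ : Measure E3} (hG : ∀ i, AEStronglyMeasurable (G i) μ) :
    AEStronglyMeasurable (gradSq G) μ :=
  Finset.aestronglyMeasurable_fun_sum _ fun i _ => (hG i).norm.pow 2

theorem aestronglyMeasurable_dirDeriv {μ : Measure E3} (hG : ∀ i, AEStronglyMeasurable (G i) μ) :
    AEStronglyMeasurable (fun x => dirDeriv G (x - x₀) x) μ := by
  have hc : ∀ i : Fin 3, Continuous fun x : E3 => (x - x₀) i := fun i => by fun_prop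
  exact Finset.aestronglyMeasurable_fun_sum _ fun i _ => (hc i).aestronglyMeasurable.smul (hG i)

theorem aestronglyMeasurable_pohozaevIntegrand (hr : 0 < r) {μ : Measure E3}
    (hd : AEStronglyMeasurable d μ) (hG : ∀ i, AEStronglyMeasurable (G i) μ)
    (hg : AEStronglyMeasurable g μ) :
    AEStronglyMeasurable (pohozaevIntegrand ε x₀ r R d G g) μ := by
  obtain ⟨C, hC⟩ := lipschitzWith_radialCutoff (x₀ := x₀) (R := R) hr
  have hS := aestronglyMeasurable_gradSq hG
  have hD := aestronglyMeasurable_dirDeriv (x₀ := x₀) hG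
  have hf : AEStronglyMeasurable (fun x => 1 - ‖d x‖ ^ 2) μ :=
    aestronglyMeasurable_const.sub (hd.norm.pow 2)
  have hy : AEStronglyMeasurable (fun x : E3 => ‖x - x₀‖) μ :=
    Continuous.aestronglyMeasurable (by fun_prop)
  refine AEStronglyMeasurable.sub (hC.continuous.aestronglyMeasurable.mul
    (((hg.add ((hf.const_mul _).smul hd)).inner hD).sub
      ((hS.const_mul _).add ((hf.pow 2).const_mul _)))) (AEStronglyMeasurable.indicator ?_
        (measurableSet_ball.diff measurableSet_ball))
  refine AEStronglyMeasurable.mul ?_ ((hD.norm.pow 2).sub ((hy.pow 2).mul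
    ((hS.const_mul _).add ((hf.pow 2).const_mul _))))
  exact ((measurable_norm.comp (measurable_id.sub_const x₀)).inv.pow_const 3).aestronglyMeasurable

theorem tendsto_pohozaevIntegrand {dn : ℕ → E3 → E3} {Gn : ℕ → Fin 3 → E3 → E3} {gn : ℕ → E3 → E3}
    {x : E3} (hd : Filter.Tendsto (fun n => dn n x) Filter.atTop (nhds (d x)))
    (hG : ∀ i, Filter.Tendsto (fun n => Gn n i x) Filter.atTop (nhds (G i x)))
    (hg : Filter.Tendsto (fun n => gn n x) Filter.atTop (nhds (g x))) :
    Filter.Tendsto (fun n => pohozaevIntegrand ε x₀ r R (dn n) (Gn n) (gn n) x) Filter.atTop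
      (nhds (pohozaevIntegrand ε x₀ r R d G g x)) := by
  have hS : Filter.Tendsto (fun n => gradSq (Gn n) x) Filter.atTop (nhds (gradSq G x)) :=
    tendsto_finsetSum _ fun i _ => (hG i).norm.pow 2
  have hD : Filter.Tendsto (fun n => dirDeriv (Gn n) (x - x₀) x) Filter.atTop
      (nhds (dirDeriv G (x - x₀) x)) := tendsto_finsetSum _ fun i _ => (hG i).const_smul _
  have hf : Filter.Tendsto (fun n => 1 - ‖dn n x‖ ^ 2) Filter.atTop (nhds (1 - ‖d x‖ ^ 2)) :=
    (hd.norm.pow 2).const_sub 1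
  refine Filter.Tendsto.sub (((((hg.add ((hf.const_mul _).smul hd)).inner hD).sub
    ((hS.const_mul _).add ((hf.pow 2).const_mul _)))).const_mul _) ?_
  by_cases hA : x ∈ Metric.ball x₀ R \ Metric.ball x₀ r
  · simp only [Set.indicator_of_mem hA]
    exact ((hD.norm.pow 2).sub (((hS.const_mul _).add ((hf.pow 2).const_mul _)).const_mul _)).const_mul _
  · simp only [Set.indicator_of_notMem hA]
    exact tendsto_const_nhds

end PohozaevIntegrand

/-! ### Balls inside the domain and the Pohozaev identity for weak solutions -/

theorem closedBall_subset_of_lt_infEDist_frontier {Ω : Set E3} {x₀ : E3} (hx₀ : x₀ ∈ Ω) {R : ℝ}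
    (hR : ENNReal.ofReal R < Metric.infEDist x₀ (frontier Ω)) : Metric.closedBall x₀ R ⊆ Ω := by
  rcases lt_or_ge R 0 with h | h
  · simp [Metric.closedBall_eq_empty.2 h]
  have hdisj : Disjoint (frontier Ω) (Metric.closedBall x₀ R) := by
    rw [Set.disjoint_right]
    intro y hy hyf
    refine absurd ((Metric.infEDist_le_edist_of_mem hyf).trans ?_) (not_le.2 hR)
    rw [edist_comm, edist_dist]
    exact ENNReal.ofReal_le_ofReal hy
  -- A connected set missing the frontier and meeting the interior cannot reach the exterior.
  have hpre : IsPreconnected (Metric.closedBall x₀ R) :=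
    (convex_closedBall x₀ R).isPreconnected
  by_contra hns
  obtain ⟨y, hy, hyΩ⟩ := Set.not_subset.1 hns
  have hcl : ∀ z ∈ Metric.closedBall x₀ R, z ∉ frontier Ω := fun z hz hf =>
    Set.disjoint_left.1 hdisj hf hz
  obtain ⟨z, _, hz1, hz2⟩ := hpre (interior Ω) (closure Ω)ᶜ isOpen_interior
    isClosed_closure.isOpen_compl
    (fun z hz => by
      by_cases hzc : z ∈ closure Ω
      · left
        by_contra hi
        exact hcl z hz ⟨hzc, hi⟩
      · exact Or.inr hzc)
    ⟨x₀, Metric.mem_closedBall_self h, by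
      by_contra hi
      exact hcl x₀ (Metric.mem_closedBall_self h) ⟨subset_closure hx₀, hi⟩⟩
    ⟨y, hy, fun hyc => hcl y hy ⟨hyc, fun hi => hyΩ (interior_subset hi)⟩⟩
  exact hz2 (subset_closure (interior_subset hz1))

theorem integrable_gradSq {μ : Measure E3} {G : Fin 3 → E3 → E3} (hG : ∀ i, MemLp (G i) 2 μ) :
    Integrable (gradSq G) μ :=
  integrable_finsetSum _ fun i _ => (memLp_two_iff_integrable_sq_norm (hG i).1).1 (hG i)

theorem gradSq_mollify_le (φ : ContDiffBump (0 : E3)) {G : Fin 3 → E3 → E3} {g : E3 → E3}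
    (hG : ∀ i, MemLp (G i) 2) (hg : MemLp g 2) (x : E3) :
    gradSq (fun i => mollify φ (G i)) x + ‖mollify φ g x‖ ^ 2 ≤
      mollify φ (fun t => gradSq G t + ‖g t‖ ^ 2) x := by
  have hsq : ∀ {h : E3 → E3}, MemLp h 2 → LocallyIntegrable fun t => ‖h t‖ ^ 2 := fun hh =>
    ((memLp_two_iff_integrable_sq_norm hh.1).1 hh).locallyIntegrable
  have hloc : ∀ {h : E3 → E3}, MemLp h 2 → LocallyIntegrable h := fun hh =>
    hh.locallyIntegrable (by norm_num)
  have hle : ∀ {h : E3 → E3}, MemLp h 2 → ‖mollify φ h x‖ ^ 2 ≤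
      mollify φ (fun t => ‖h t‖ ^ 2) x := fun hh => norm_mollify_sq_le φ (hloc hh) (hsq hh) x
  refine (add_le_add (Finset.sum_le_sum fun i _ => hle (hG i)) (hle hg)).trans_eq ?_
  simp only [mollify_apply]
  rw [← integral_finsetSum _ fun i _ => integrable_normed_smul φ (hsq (hG i)) x, ← integral_add
    (integrable_finsetSum _ fun i _ => integrable_normed_smul φ (hsq (hG i)) x)
    (integrable_normed_smul φ (hsq hg) x)]
  simp only [gradSq, smul_add, Finset.smul_sum]

section WeakSolution

variable {Ω : Set E3} {ε : ℝ} {d : E3 → E3} {G : Fin 3 → E3 → E3} {τ : E3 → E3}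

theorem memLp_nonlinearity (hd : MemLp d 2 (volume.restrict Ω))
    (hbound : ∀ᵐ x ∂(volume.restrict Ω), ‖d x‖ ≤ 1) :
    MemLp (fun x => (1 / ε ^ 2 * (1 - ‖d x‖ ^ 2)) • d x) 2 (volume.restrict Ω) := by
  refine hd.of_le_mul (c := 1 / ε ^ 2)
    (((aestronglyMeasurable_const.sub (hd.1.norm.pow 2)).const_mul _).smul hd.1) ?_
  filter_upwards [hbound] with x hx
  have h0 : 0 ≤ 1 - ‖d x‖ ^ 2 := by nlinarith [norm_nonneg (d x)]
  have h1 : 1 - ‖d x‖ ^ 2 ≤ 1 := by nlinarith [norm_nonneg (d x)]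
  rw [norm_smul, Real.norm_of_nonneg (by positivity)]
  exact mul_le_mul_of_nonneg_right (mul_le_of_le_one_right (by positivity) h1) (norm_nonneg _)

theorem integral_pohozaevIntegrand_eq_zero (hΩ : IsOpen Ω) (hd : IsH1WithGradient Ω d G)
    (hsol : IsWeakSolutionAGL Ω ε d G τ)
    (hbound : ∀ᵐ x ∂(volume.restrict Ω), ‖d x‖ ≤ 1) (hτ : MemLp τ 2 (volume.restrict Ω))
    {x₀ : E3} {r R : ℝ} (hr : 0 < r) (hrR : r ≤ R) (hR : Metric.closedBall x₀ R ⊆ Ω) :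
    Integrable (pohozaevIntegrand ε x₀ r R d G
        fun x => τ x - (1 / ε ^ 2 * (1 - ‖d x‖ ^ 2)) • d x) ∧
      ∫ x, pohozaevIntegrand ε x₀ r R d G
        (fun x => τ x - (1 / ε ^ 2 * (1 - ‖d x‖ ^ 2)) • d x) x = 0 := by
  have hΩm := hΩ.measurableSet
  set N : E3 → E3 := fun x => (1 / ε ^ 2 * (1 - ‖d x‖ ^ 2)) • d x with hN
  have hN2 : MemLp N 2 (volume.restrict Ω) := memLp_nonlinearity hd.memLp hbound
  set d' := Ω.indicator d with hd'
  set G' := fun i => Ω.indicator (G i) with hG'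
  set g' := Ω.indicator fun x => τ x - N x with hg'
  have hi : ∀ {h : E3 → E3}, MemLp h 2 (volume.restrict Ω) → MemLp (Ω.indicator h) 2 := fun hh =>
    (memLp_indicator_iff_restrict hΩm).2 hh
  have hloc : ∀ {h : E3 → E3}, MemLp h 2 → LocallyIntegrable h := fun hh =>
    hh.locallyIntegrable (by norm_num)
  have hd2 : MemLp d' 2 := hi hd.memLp
  have hG2 : ∀ i, MemLp (G' i) 2 := fun i => hi (hd.memLp_grad i)
  have hg2 : MemLp g' 2 := hi (hτ.sub hN2)
  have hbd : ∀ᵐ x, ‖d' x‖ ≤ 1 := by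
    filter_upwards [(ae_restrict_iff' hΩm).1 hbound] with x hx
    by_cases h : x ∈ Ω
    · simpa [hd', h] using hx h
    · simp [hd', h]
  -- With mollification radii at most `δ`, values on `B_R` involve only points of `Ω`, where the
  -- weak equations hold.
  obtain ⟨δ, hδ, hδΩ⟩ := (isCompact_closedBall x₀ R).exists_cthickening_subset_open hΩ hR
  let φ : ℕ → ContDiffBump (0 : E3) := fun n =>
    ⟨δ / (n + 1) / 2, δ / (n + 1), by positivity, half_lt_self (by positivity)⟩
  have hφδ : ∀ n, (φ n).rOut ≤ δ := fun n => by
    change δ / (n + 1) ≤ δ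
    exact div_le_self hδ.le (by simp)
  have hφ0 : Filter.Tendsto (fun n => (φ n).rOut) Filter.atTop (nhds 0) := by
    have := tendsto_one_div_add_atTop_nhds_zero_nat (𝕜 := ℝ) |>.const_mul δ
    simpa only [mul_one_div, mul_zero] using this
  -- Comparable inner and outer radii are what the almost everywhere convergence of mollifications
  -- (Lebesgue differentiation) requires.
  have hφK : ∀ᶠ n in Filter.atTop, (φ n).rOut ≤ 2 * (φ n).rIn :=
    Filter.Eventually.of_forall fun n => by
      change δ / (n + 1) ≤ 2 * (δ / (n + 1) / 2)
      linarith
  have hφΩ : ∀ n, ∀ x ∈ Metric.ball x₀ R, Metric.closedBall x (φ n).rOut ⊆ Ω := fun n x hx =>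
    ((Metric.closedBall_subset_closedBall (hφδ n)).trans
      (Metric.closedBall_subset_cthickening (Metric.ball_subset_closedBall hx) δ)).trans hδΩ
  have hpartial : ∀ n i, ∀ x ∈ Metric.ball x₀ R,
      vecPartial i (mollify (φ n) d') x = mollify (φ n) (G' i) x := fun n i x hx =>
    vecPartial_mollify_indicator hΩm (hd.weakDeriv i) (hloc hd2) (hφΩ n x hx)
  have hlap : ∀ n, ∀ x ∈ Metric.ball x₀ R,
      ∑ i, vecPartial i (vecPartial i (mollify (φ n) d')) x = mollify (φ n) g' x := by
    intro n x hx
    rw [hg', ← sum_vecPartial_mollify_indicator hΩm hsol (fun i => hloc (hG2 i)) (hloc (hi hN2))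
      (hloc (hi hτ)) (hφΩ n x hx)]
    refine Finset.sum_congr rfl fun i _ => ?_
    -- A second differentiation needs equality on a neighbourhood, available because the ball is
    -- open.
    have : vecPartial i (mollify (φ n) d') =ᶠ[nhds x] mollify (φ n) (G' i) := by
      filter_upwards [Metric.isOpen_ball.mem_nhds hx] with y hy using hpartial n i y hy
    rw [vecPartial, this.fderiv_eq, vecPartial]
  set P : ℕ → E3 → ℝ := fun n => pohozaevIntegrand ε x₀ r R (mollify (φ n) d')
    (fun i => mollify (φ n) (G' i)) (mollify (φ n) g') with hP
  have hP0 : ∀ n, ∫ x, P n x = 0 := by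
    intro n
    rw [← integral_pohozaevIntegrand_of_contDiff (contDiff_mollify (φ n) (hloc hd2)) ε x₀ hr hrR]
    congr 1 with x
    exact pohozaevIntegrand_congr hr hrR fun hx =>
      ⟨rfl, fun i => (hpartial n i x hx).symm, (hlap n x hx).symm⟩
  set C := r⁻¹ * (3 + R ^ 2 + 1 / ε ^ 2 + (1 / ε ^ 2) ^ 2) with hC
  have hC0 : 0 ≤ C := by positivity
  set q : E3 → ℝ := fun t => gradSq G' t + ‖g' t‖ ^ 2 with hq
  have hqi : Integrable q :=
    (integrable_gradSq hG2).add ((memLp_two_iff_integrable_sq_norm hg2.1).1 hg2)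
  have hball : Integrable ((Metric.ball x₀ R).indicator fun _ => (1 : ℝ)) :=
    (integrable_indicator_iff measurableSet_ball).2
      (integrableOn_const measure_ball_lt_top.ne)
  have hmeas : AEStronglyMeasurable (pohozaevIntegrand ε x₀ r R d' G' g') volume :=
    aestronglyMeasurable_pohozaevIntegrand hr hd2.1 (fun i => (hG2 i).1) hg2.1
  have hcont : ∀ n {h : E3 → E3}, MemLp h 2 → AEStronglyMeasurable (mollify (φ n) h) volume :=
    fun n h hh => (contDiff_mollify (φ n) (hloc hh)).continuous.aestronglyMeasurable
  have hconv : ∀ {h : E3 → E3}, MemLp h 2 → ∀ᵐ x,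
      Filter.Tendsto (fun n => mollify (φ n) h x) Filter.atTop (nhds (h x)) := fun hh =>
    ContDiffBump.ae_convolution_tendsto_right_of_locallyIntegrable hφ0 hφK (hloc hh)
  have hlim : Filter.Tendsto (fun n => ∫ x, P n x) Filter.atTop
      (nhds (∫ x, pohozaevIntegrand ε x₀ r R d' G' g' x)) := by
    refine tendsto_integral_of_tendsto_dominating
      (D := fun n x => C * ((Metric.ball x₀ R).indicator (fun _ => 1) x + mollify (φ n) q x))
      (g := fun x => C * ((Metric.ball x₀ R).indicator (fun _ => 1) x + q x))
      (fun n => ?_) (fun n => ?_) ((hball.add hqi).const_mul C) (fun n => ?_) ?_ ?_ ?_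
    · exact aestronglyMeasurable_pohozaevIntegrand hr (hcont n hd2) (fun i => hcont n (hG2 i))
        (hcont n hg2)
    · exact (hball.add (integrable_mollify (φ n) hqi)).const_mul C
    · refine Filter.Eventually.of_forall fun x => ?_
      refine (abs_pohozaevIntegrand_le hr hrR (norm_mollify_le_one (φ n) hbd x)).trans ?_
      exact mul_le_mul_of_nonneg_left
        (add_le_add_right (gradSq_mollify_le (φ n) hG2 hg2 x) _) hC0
    · filter_upwards [ContDiffBump.ae_convolution_tendsto_right_of_locallyIntegrable
        (μ := (volume : Measure E3)) hφ0 hφK hqi.locallyIntegrable] with x hx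
      exact (hx.const_add _).const_mul C
    · filter_upwards [hconv hd2, ae_all_iff.2 fun i => hconv (hG2 i), hconv hg2] with x h1 h2 h3
      exact tendsto_pohozaevIntegrand h1 h2 h3
    -- Mollification preserves the integral, so all the majorants have the same integral as their
    -- limit.
    · refine tendsto_const_nhds.congr fun n => ?_
      rw [integral_const_mul, integral_const_mul, integral_add hball hqi,
        integral_add hball (integrable_mollify (φ n) hqi), integral_mollify (φ n) hqi]
  have hcongr : pohozaevIntegrand ε x₀ r R d G (fun x => τ x - N x) =
      pohozaevIntegrand ε x₀ r R d' G' g' := by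
    funext x
    refine pohozaevIntegrand_congr hr hrR fun hx => ?_
    have hxΩ := hR (Metric.ball_subset_closedBall hx)
    simp [hd', hG', hg', hxΩ]
  rw [hcongr]
  refine ⟨((hball.add hqi).const_mul C).mono' hmeas ?_, ?_⟩
  · filter_upwards [hbd] with x hx using abs_pohozaevIntegrand_le hr hrR hx
  · simp only [hP0] at hlim
    exact tendsto_nhds_unique hlim tendsto_const_nhds

end WeakSolution

/-! ### The monotonicity inequality -/

theorem integrableOn_energyDensity_sub_inner {ε : ℝ} {d : E3 → E3} {G : Fin 3 → E3 → E3}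
    {τ : E3 → E3} {B : Set E3} {x₀ : E3} {R : ℝ} (hB : MeasurableSet B)
    (hBR : B ⊆ Metric.ball x₀ R) (hd : AEStronglyMeasurable d (volume.restrict B))
    (hbound : ∀ᵐ x ∂(volume.restrict B), ‖d x‖ ≤ 1) (hG : ∀ i, MemLp (G i) 2 (volume.restrict B))
    (hτ : MemLp τ 2 (volume.restrict B)) :
    IntegrableOn (fun x => energyDensity ε d G x - ⟪dirDeriv G (x - x₀) x, τ x⟫) B := by
  have hD := aestronglyMeasurable_dirDeriv (x₀ := x₀) fun i => (hG i).1
  have hS := integrable_gradSq hG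
  have hfin : IsFiniteMeasure (volume.restrict B) :=
    ⟨by simpa using (measure_mono hBR).trans_lt measure_ball_lt_top⟩
  refine ((hS.const_mul _).add ?_).sub ?_
  · refine (Integrable.of_bound (((aestronglyMeasurable_const.sub (hd.norm.pow 2))).pow 2) 1 ?_).const_mul _
    filter_upwards [hbound] with x hx
    have h0 : 0 ≤ 1 - ‖d x‖ ^ 2 := by nlinarith [norm_nonneg (d x)]
    have h1 : 1 - ‖d x‖ ^ 2 ≤ 1 := by nlinarith [norm_nonneg (d x)]
    change ‖(1 - ‖d x‖ ^ 2) ^ 2‖ ≤ 1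
    rw [Real.norm_of_nonneg (sq_nonneg _)]
    exact pow_le_one₀ h0 h1
  · have hτ2 := (memLp_two_iff_integrable_sq_norm hτ.1).1 hτ
    refine ((hS.const_mul (R ^ 2)).add hτ2).mono' (hD.inner hτ.1) ?_
    filter_upwards [ae_restrict_mem hB] with x hx
    have hxR : ‖x - x₀‖ ≤ R := (mem_ball_iff_norm.1 (hBR hx)).le
    have h1 := (norm_dirDeriv_sq_le G (x - x₀) x).trans (mul_le_mul_of_nonneg_right
      (pow_le_pow_left₀ (norm_nonneg _) hxR 2) (gradSq_nonneg G x))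
    refine (norm_inner_le_norm (𝕜 := ℝ) _ _).trans ?_
    simp only [Pi.add_apply]
    nlinarith [sq_nonneg (‖dirDeriv G (x - x₀) x‖ - ‖τ x‖), sq_nonneg (‖dirDeriv G (x - x₀) x‖),
      sq_nonneg ‖τ x‖]

/-- The radial part of the derivative of the renormalized energy dominates the defect. -/
theorem radial_defect_le {ε : ℝ} {d : E3 → E3} {G : Fin 3 → E3 → E3} {τ : E3 → E3} {x₀ x : E3}
    (hx : 0 < ‖x - x₀‖) :
    1 / 2 * (1 / ‖x - x₀‖ * (‖radialDeriv G x₀ x‖ ^ 2 + (1 - ‖d x‖ ^ 2) ^ 2 / ε ^ 2)) ≤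
      ‖x - x₀‖⁻¹ * (energyDensity ε d G x - ⟪dirDeriv G (x - x₀) x, τ x⟫) +
        (‖x - x₀‖⁻¹) ^ 3 * (‖dirDeriv G (x - x₀) x‖ ^ 2 - ‖x - x₀‖ ^ 2 *
          (1 / 2 * gradSq G x + 1 / (4 * ε ^ 2) * (1 - ‖d x‖ ^ 2) ^ 2)) +
        1 / 2 * (‖x - x₀‖ * ‖τ x‖ ^ 2) := by
  -- The right side minus the left is exactly `½|y|⁻¹` times this square: the `|∇d|²` terms cancel
  -- and the potentials `3/4 - 1/4` leave the required `1/2`.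
  have hsq : ‖‖x - x₀‖⁻¹ • dirDeriv G (x - x₀) x - ‖x - x₀‖ • τ x‖ ^ 2 =
      (‖x - x₀‖⁻¹) ^ 2 * ‖dirDeriv G (x - x₀) x‖ ^ 2 - 2 * ⟪dirDeriv G (x - x₀) x, τ x⟫ +
        ‖x - x₀‖ ^ 2 * ‖τ x‖ ^ 2 := by
    rw [norm_sub_sq_real, norm_smul, norm_smul, real_inner_smul_left, real_inner_smul_right,
      norm_inv, norm_norm, mul_pow, mul_pow, inv_mul_cancel_left₀ hx.ne']
  have hpos : 0 ≤ 1 / 2 * ‖x - x₀‖⁻¹ *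
      ‖‖x - x₀‖⁻¹ • dirDeriv G (x - x₀) x - ‖x - x₀‖ • τ x‖ ^ 2 := by positivity
  rw [hsq] at hpos
  rw [radialDeriv, dirDeriv_smul, norm_smul, norm_inv, norm_norm, energyDensity]
  refine le_of_sub_nonneg (hpos.trans_eq ?_)
  field_simp
  ring

theorem lemma3p1 (Ω : Set E3) (hΩ : IsOpen Ω) (ε : ℝ) (hε : 0 < ε)
    (d : E3 → E3) (G : Fin 3 → E3 → E3) (τ : E3 → E3)
    (hd : IsH1WithGradient Ω d G)
    (hsol : IsWeakSolutionAGL Ω ε d G τ)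
    (hbound : ∀ᵐ x ∂(volume.restrict Ω), ‖d x‖ ≤ 1)
    (hτ : MemLp τ 2 (volume.restrict Ω))
    (x₀ : E3) (hx₀ : x₀ ∈ Ω) (r R : ℝ) (hr : 0 < r) (hrR : r ≤ R)
    (hR : ENNReal.ofReal R < Metric.infEDist x₀ (frontier Ω)) :
    renormalizedEnergy ε d G τ x₀ R ≥
      renormalizedEnergy ε d G τ x₀ r
        + 1 / 2 * ∫ x in Metric.ball x₀ R \ Metric.ball x₀ r,
            1 / ‖x - x₀‖ * (‖radialDeriv G x₀ x‖ ^ 2 + (1 - ‖d x‖ ^ 2) ^ 2 / ε ^ 2) := by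
  have hBΩ := closedBall_subset_of_lt_infEDist_frontier hx₀ hR
  obtain ⟨hPi, hP0⟩ := integral_pohozaevIntegrand_eq_zero hΩ hd hsol hbound hτ hr hrR hBΩ
  set P := pohozaevIntegrand ε x₀ r R d G
    (fun x => τ x - (1 / ε ^ 2 * (1 - ‖d x‖ ^ 2)) • d x) with hP
  set B := Metric.ball x₀ R with hB
  set b := Metric.ball x₀ r with hb
  have hbB : b ⊆ B := Metric.ball_subset_ball hrR
  have hBm : MeasurableSet B := measurableSet_ball
  have hbm : MeasurableSet b := measurableSet_ball
  have hAm : MeasurableSet (B \ b) := hBm.diff hbm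
  have hdisj : Disjoint b (B \ b) := Set.disjoint_sdiff_right
  have hunion : b ∪ B \ b = B := Set.union_sdiff_cancel hbB
  have hrestr : volume.restrict B ≤ volume.restrict Ω :=
    Measure.restrict_mono (Metric.ball_subset_closedBall.trans hBΩ) le_rfl
  have hτB := hτ.mono_measure hrestr
  set h : E3 → ℝ := fun x => energyDensity ε d G x - ⟪dirDeriv G (x - x₀) x, τ x⟫ with hh
  set s : E3 → ℝ := fun x => ‖x - x₀‖ * ‖τ x‖ ^ 2 with hs
  set q : E3 → ℝ := fun x => ‖x - x₀‖⁻¹ * h x +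
    (‖x - x₀‖⁻¹) ^ 3 * (‖dirDeriv G (x - x₀) x‖ ^ 2 - ‖x - x₀‖ ^ 2 *
      (1 / 2 * gradSq G x + 1 / (4 * ε ^ 2) * (1 - ‖d x‖ ^ 2) ^ 2)) with hq
  have hhi : IntegrableOn h B :=
    integrableOn_energyDensity_sub_inner hBm subset_rfl (hd.memLp.mono_measure hrestr).1
      (ae_mono hrestr hbound) (fun i => (hd.memLp_grad i).mono_measure hrestr) hτB
  have hsi : IntegrableOn s B := by
    have hτ2 := (memLp_two_iff_integrable_sq_norm hτB.1).1 hτB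
    refine (hτ2.const_mul R).mono' (AEStronglyMeasurable.mul
      (Continuous.aestronglyMeasurable (by fun_prop)) hτ2.1) ?_
    filter_upwards [ae_restrict_mem hBm] with x hx
    rw [Real.norm_of_nonneg (by positivity)]
    exact mul_le_mul_of_nonneg_right (mem_ball_iff_norm.1 hx).le (sq_nonneg _)
  have hPout : ∀ x ∉ B, P x = 0 := fun x hx => pohozaevIntegrand_of_notMem hr hrR hx
  -- The source `τ - ε⁻²(1 - |d|²)d` cancels the nonlinear term in the integrand, leaving minus the
  -- weight times `h`.
  have hPb : ∀ x ∈ b, P x = -(r⁻¹ - R⁻¹) * h x := by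
    intro x hx
    rw [hP, pohozaevIntegrand, radialCutoff_of_mem_ball hr hrR hx,
      Set.indicator_of_notMem fun hA => hA.2 hx, sub_add_cancel, real_inner_comm]
    simp only [hh]
    ring
  have hPA : ∀ x ∈ B \ b, P x = R⁻¹ * h x - q x := by
    intro x hx
    rw [hP, pohozaevIntegrand, radialCutoff_of_mem_annulus hr hx, Set.indicator_of_mem hx,
      sub_add_cancel, real_inner_comm]
    simp only [hh, hq]
    ring
  -- On the annulus `q` is a combination of `h` and `P`, so its integrability is inherited from
  -- theirs.
  have hqi : IntegrableOn q (B \ b) := by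
    refine (((hhi.mono_set Set.sdiff_subset).const_mul R⁻¹).sub hPi.integrableOn).congr ?_
    filter_upwards [ae_restrict_mem hAm] with x hx
    simp only [Pi.sub_apply, hPA x hx]
    ring
  have hsplit : ∀ {k : E3 → ℝ}, IntegrableOn k B →
      ∫ x in B, k x = (∫ x in b, k x) + ∫ x in B \ b, k x := fun {k} hk => by
    rw [← setIntegral_union hdisj hAm (hk.mono_set hbB) (hk.mono_set Set.sdiff_subset), hunion]
  have hid : R⁻¹ * (∫ x in B, h x) = r⁻¹ * (∫ x in b, h x) + ∫ x in B \ b, q x := by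
    rw [← setIntegral_eq_integral_of_forall_compl_eq_zero hPout, hsplit hPi.integrableOn,
      setIntegral_congr_fun hbm hPb, setIntegral_congr_fun hAm hPA, integral_const_mul,
      integral_sub ((hhi.mono_set Set.sdiff_subset).const_mul R⁻¹) hqi, integral_const_mul] at hP0
    rw [hsplit hhi]
    linarith
  have hdefect : 1 / 2 * ∫ x in B \ b,
      1 / ‖x - x₀‖ * (‖radialDeriv G x₀ x‖ ^ 2 + (1 - ‖d x‖ ^ 2) ^ 2 / ε ^ 2) ≤
      (∫ x in B \ b, q x) + 1 / 2 * ∫ x in B \ b, s x := by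
    have hsA := (hsi.mono_set (Set.sdiff_subset (t := b))).const_mul (1 / 2)
    rw [← integral_const_mul, ← integral_const_mul, ← integral_add hqi hsA]
    -- Nonnegativity of the defect makes a separate proof of its integrability unnecessary.
    refine integral_mono_of_nonneg (Filter.Eventually.of_forall fun x => ?_) (hqi.add hsA) ?_
    · simp only [Pi.zero_apply]
      positivity
    · filter_upwards [ae_restrict_mem hAm] with x hx
      exact radial_defect_le (hr.trans_le (not_lt.1 fun hlt => hx.2 (mem_ball_iff_norm.2 hlt)))
  rw [ge_iff_le, renormalizedEnergy, renormalizedEnergy, ← hB, ← hb, one_div R, one_div r, hid,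
    hsplit hsi]
  linarith
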